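/- Let $n\ge 1$ and $\hbar>0$. Equip $\mathbb{R}^{2n}=\mathbb{R}^n_x\times\mathbb{R}^n_p$ with the symplectic form $\sigma((x,p),(x',p'))=p\cdot x'-x\cdot p'$, and let $\mathrm{Sp}(n)$ be the group of linear automorphisms of $\mathbb{R}^{2n}$ preserving $\sigma$. Let $B_X^n(R)\subset\mathbb{R}^n_x$, $B_P^n(R)\subset\mathbb{R}^n_p$ and $B^{2n}(R)\subset\mathbb{R}^{2n}$ denote the closed Euclidean balls of radius $R$ centered at $0$. Let $(\ell,\ell')$ be a Lagrangian frame, i.e. a pair of $n$-dimensional linear subspaces of $\mathbb{R}^{2n}$ on each of which $\sigma$ vanishes, with $\ell\cap\ell'=0$. Let $X_\ell\subset\ell$ be an ellipsoid in $\ell$ centered at the origin, i.e. $X_\ell=\{z\in\ell: Q(z)\le 1\}$ for a positive definite quadratic form $Q$ on $\ell$, and let $$(X_\ell)^\hbar_{\ell'}=\{z'\in\ell' : \sup_{z\in X_\ell}\sigma(z,z')\le\hbar\}$$ be its Lagrangian polar dual. Identify $\ell\times\ell'$ with $\ell\oplus\ell'=\mathbb{R}^{2n}$ through $(z,z')\mapsto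 z+z'$, so that the geometric quantum state $X_\ell\times(X_\ell)^\hbar_{\ell'}$ is the subset $\{z+z' : z\in X_\ell,\ z'\in(X_\ell)^\hbar_{\ell'}\}$ of $\mathbb{R}^{2n}$. Then: (i) There exists $S\in\mathrm{Sp}(n)$ such that $$X_\ell\times(X_\ell)^\hbar_{\ell'}=S\bigl(B_X^n(\sqrt\hbar)\times B_P^n(\sqrt\hbar)\bigr).$$ (ii) The John ellipsoid of $X_\ell\times(X_\ell)^\hbar_{\ell'}$, i.e. the unique ellipsoid (with arbitrary center) of maximal volume contained in it, exists and is a quantum blob: it equals $S'(B^{2n}(\sqrt\hbar))$ for some $S'\in\mathrm{Sp}(n)$. -/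

import Mathlib

open scoped Pointwise

noncomputable section

/-- Phase space `ℝ²ⁿ = ℝₓⁿ × ℝₚⁿ` with its Euclidean structure: the `Sum.inl` coordinates are
the positions `x`, the `Sum.inr` coordinates are the momenta `p`. -/
abbrev PhaseSpace (n : ℕ) : Type := EuclideanSpace ℝ (Fin n ⊕ Fin n)

/-- The position component `x ∈ ℝⁿ` of `z = (x, p)`. -/
def posPart {n : ℕ} (z : PhaseSpace n) : EuclideanSpace ℝ (Fin n) :=
  WithLp.toLp 2 fun i => z (Sum.inl i)

/-- The momentum component `p ∈ ℝⁿ` of `z = (x, p)`. -/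
def momPart {n : ℕ} (z : PhaseSpace n) : EuclideanSpace ℝ (Fin n) :=
  WithLp.toLp 2 fun i => z (Sum.inr i)

/-- The standard symplectic form `σ = ∑ dpⱼ ∧ dxⱼ`, i.e. `σ((x,p),(x',p')) = p·x' - x·p'`. -/
def stdSymp {n : ℕ} (z z' : PhaseSpace n) : ℝ :=
  inner ℝ (momPart z) (posPart z') - inner ℝ (posPart z) (momPart z')

/-- The action of a symplectic matrix `S ∈ Sp(n)` on subsets of phase space. -/
def spImage {n : ℕ} (S : Matrix.symplecticGroup (Fin n) ℝ) (A : Set (PhaseSpace n)) :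
    Set (PhaseSpace n) :=
  Matrix.toEuclideanLin (S : Matrix (Fin n ⊕ Fin n) (Fin n ⊕ Fin n) ℝ) '' A

/-- Lagrangian planes: `n`-dimensional linear subspaces on which `σ` vanishes. -/
def IsLagrangianPlane {n : ℕ} (l : Submodule ℝ (PhaseSpace n)) : Prop :=
  Module.finrank ℝ l = n ∧ ∀ z ∈ l, ∀ z' ∈ l, stdSymp z z' = 0

/-- Lagrangian frames: transversal pairs of Lagrangian planes. -/
def IsLagrangianFrame {n : ℕ} (l l' : Submodule ℝ (PhaseSpace n)) : Prop :=
  IsLagrangianPlane l ∧ IsLagrangianPlane l' ∧ l ⊓ l' = ⊥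

/-- (Nondegenerate, solid) ellipsoids with center `c` in a real vector space. -/
def IsEllipsoidAt {V : Type*} [AddCommGroup V] [Module ℝ V] (c : V) (E : Set V) : Prop :=
  ∃ Q : QuadraticForm ℝ V, Q.PosDef ∧ E = {z | Q (z - c) ≤ 1}

/-- Ellipsoids centered at the origin and carried by the subspace `l`. -/
def IsCenteredEllipsoidIn {n : ℕ} (l : Submodule ℝ (PhaseSpace n)) (X : Set (PhaseSpace n)) :
    Prop :=
  ∃ E : Set l, IsEllipsoidAt 0 E ∧ X = Subtype.val '' E

/-- The Lagrangian polar dual `{z' ∈ l' : sup_{z ∈ X} σ(z, z') ≤ ħ}`. -/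
def lagrangianPolarDual {n : ℕ} (ħ : ℝ) (l' : Submodule ℝ (PhaseSpace n))
    (X : Set (PhaseSpace n)) : Set (PhaseSpace n) :=
  {z' | z' ∈ l' ∧ ∀ z ∈ X, stdSymp z z' ≤ ħ}

/-- The geometric quantum state `X × X^ħ_{l'}`. The product of `A ⊆ l` and `B ⊆ l'` is taken
under the identification `l × l' ≃ l ⊕ l' = ℝ²ⁿ`, `(z, z') ↦ z + z'`, so it is the set sum. -/
def geometricState {n : ℕ} (ħ : ℝ) (l' : Submodule ℝ (PhaseSpace n))
    (X : Set (PhaseSpace n)) : Set (PhaseSpace n) :=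
  X + lagrangianPolarDual ħ l' X

/-- The product of closed balls `B_X^n(R) × B_P^n(R)` in `ℝₓⁿ × ℝₚⁿ`. -/
def ballProduct (n : ℕ) (R : ℝ) : Set (PhaseSpace n) :=
  {z | posPart z ∈ Metric.closedBall 0 R ∧ momPart z ∈ Metric.closedBall 0 R}

/-- The centered quantum blob `Q_S = S(B²ⁿ(√ħ))`. -/
def quantumBlob {n : ℕ} (ħ : ℝ) (S : Matrix.symplecticGroup (Fin n) ℝ) : Set (PhaseSpace n) :=
  spImage S (Metric.closedBall 0 (Real.sqrt ħ))

/-- `E` is the John ellipsoid of `Ω`: the unique ellipsoid (with arbitrary center) of maximal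
volume contained in `Ω`. -/
def IsJohnEllipsoid {n : ℕ} (Ω E : Set (PhaseSpace n)) : Prop :=
  ((∃ c, IsEllipsoidAt c E) ∧ E ⊆ Ω) ∧
    ∀ E' : Set (PhaseSpace n), (∃ c, IsEllipsoidAt c E') → E' ⊆ Ω → E' ≠ E →
      MeasureTheory.volume E' < MeasureTheory.volume E

end

/-! Choose linear coordinates `e` on `l` in which `X` is the ball of radius `√ħ`. Since `l'` is
isotropic and `l + l'` is everything, `σ` pairs `l'` perfectly with `l`, which gives dual
coordinates `f` on `l'` (`IsLagrangianFrame.exists_dual`). The map `(x, p) ↦ e x + f p` is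
symplectic because both planes are isotropic. It sends the ball product to the geometric state,
because the ball of radius `√ħ` is its own polar dual at level `ħ`.

A linear automorphism multiplies all volumes by one factor, so the John ellipsoid only has to be
found for the ball product. That set contains the ball of radius `R = √ħ` and lies in the cube of
half-width `R`. An ellipsoid `c + A(B_R)` in the cube satisfies `|cᵢ| + R‖Aᵢ‖ ≤ R` for each row
`Aᵢ`, so `A Aᵀ` has diagonal at most `1`. By AM-GM on its eigenvalues `|det A| ≤ 1`, with equality
only for `A` orthogonal and `c = 0`, that is, for the ball itself. -/

/-! ### Positive definite forms and matrices -/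

/-- A positive definite real quadratic form is the squared Euclidean norm in suitable linear
coordinates. -/
theorem exists_linearEquiv_norm_sq {ι V : Type*} [Fintype ι] [AddCommGroup V] [Module ℝ V]
    [FiniteDimensional ℝ V] (hV : Module.finrank ℝ V = Fintype.card ι)
    (Q : QuadraticForm ℝ V) (hQ : Q.PosDef) :
    ∃ e : EuclideanSpace ℝ ι ≃ₗ[ℝ] V, ∀ a, Q (e a) = ‖a‖ ^ 2 := by
  obtain ⟨w, ⟨f⟩⟩ := QuadraticForm.equivalent_signType_weighted_sum_squared Q
  have hf : ∀ a, Q (f.symm a) = ∑ i, (w i : ℝ) * (a i * a i) := fun a => by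
    rw [f.symm.map_app, QuadraticMap.weightedSumSquares_apply]; simp
  -- The weights lie in `{-1, 0, 1}`; positivity on the basis vectors leaves only `1`.
  have hw : ∀ i, (w i : ℝ) = 1 := fun i => by
    have hne : f.symm (Pi.single i (1 : ℝ)) ≠ 0 := fun h => by
      have h1 : (Pi.single i (1 : ℝ) : Fin (Module.finrank ℝ V) → ℝ) = 0 :=
        f.symm.toLinearEquiv.injective (h.trans (map_zero _).symm)
      simpa using congrFun h1 i
    have h := hQ _ hne
    rw [hf, Finset.sum_eq_single i (by intro j _ hj; simp [hj]) (by simp)] at h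
    cases hi : w i
    · simp [hi] at h
    · norm_num [hi] at h
    · simp
  let r : Fin (Module.finrank ℝ V) ≃ ι := Fintype.equivOfCardEq (by simp [hV])
  refine ⟨(WithLp.linearEquiv 2 ℝ (ι → ℝ)).trans
    ((LinearEquiv.funCongrLeft ℝ ℝ r).trans f.symm.toLinearEquiv), fun a => ?_⟩
  have := hf (LinearEquiv.funCongrLeft ℝ ℝ r (WithLp.linearEquiv 2 ℝ (ι → ℝ) a))
  refine this.trans ?_
  rw [EuclideanSpace.real_norm_sq_eq, ← r.sum_comp]
  exact Finset.sum_congr rfl fun i _ => by simp [hw, sq, LinearEquiv.funCongrLeft_apply]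

/-- A positive semidefinite matrix with diagonal at most `1` and determinant at least `1` is the
identity. -/
theorem Matrix.PosSemidef.eq_one_of_diag_le_one {ι : Type*} [Fintype ι] [DecidableEq ι]
    {M : Matrix ι ι ℝ} (hM : M.PosSemidef) (hdiag : ∀ i, M i i ≤ 1) (hdet : 1 ≤ M.det) :
    M = 1 := by
  have hH := hM.isHermitian
  have hnn := hM.eigenvalues_nonneg
  have hprod : M.det = ∏ i, hH.eigenvalues i := by simpa using hH.det_eq_prod_eigenvalues
  have htr : ∑ i, (hH.eigenvalues i - 1) ≤ 0 := by
    have h : M.trace = ∑ i, hH.eigenvalues i := by simpa using hH.trace_eq_sum_eigenvalues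
    rw [Finset.sum_sub_distrib, ← h, Matrix.trace, ← Finset.sum_sub_distrib]
    exact Finset.sum_nonpos fun i _ => by simpa using hdiag i
  have hpos : ∀ i, 0 < hH.eigenvalues i := fun i => (hnn i).lt_of_ne fun h => by
    have : M.det = 0 := by rw [hprod]; exact Finset.prod_eq_zero (Finset.mem_univ i) h.symm
    linarith
  have hone : ∀ i, hH.eigenvalues i = 1 := by
    by_contra! hne
    obtain ⟨i, hi⟩ := hne
    -- AM-GM through `x ≤ exp (x - 1)`, strict for `x ≠ 1`: the product stays below `exp (∑ (λⱼ -
    -- 1)) ≤ 1`.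
    have hlt : ∏ j, hH.eigenvalues j < ∏ j, Real.exp (hH.eigenvalues j - 1) :=
      Finset.prod_lt_prod (fun j _ => hpos j)
        (fun j _ => by linarith [Real.add_one_le_exp (hH.eigenvalues j - 1)])
        ⟨i, Finset.mem_univ i, by linarith [Real.add_one_lt_exp (sub_ne_zero.2 hi)]⟩
    rw [← Real.exp_sum, ← hprod] at hlt
    linarith [Real.exp_le_one_iff.2 htr]
  have hd : (Matrix.diagonal (RCLike.ofReal ∘ hH.eigenvalues) : Matrix ι ι ℝ) = 1 := by
    rw [← Matrix.diagonal_one]; congr 1; funext i; simp [hone]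
  rw [hH.spectral_theorem, hd, map_one]

/-! ### Ellipsoids in a cube -/

theorem IsEllipsoidAt.exists_eq_image {ι : Type*} [Fintype ι] [DecidableEq ι]
    {c : EuclideanSpace ℝ ι} {E : Set (EuclideanSpace ℝ ι)} (hE : IsEllipsoidAt c E) {R : ℝ}
    (hR : 0 < R) :
    ∃ A : Matrix ι ι ℝ,
      E = (fun z => c + Matrix.toEuclideanLin A z) '' Metric.closedBall 0 R := by
  obtain ⟨Q, hQ, rfl⟩ := hE
  obtain ⟨e, he⟩ := exists_linearEquiv_norm_sq (ι := ι) (by simp) Q hQ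
  refine ⟨Matrix.toEuclideanLin.symm (R⁻¹ • e.toLinearMap), ?_⟩
  ext z
  simp only [LinearEquiv.apply_symm_apply, Set.mem_ofPred_eq, Set.mem_image,
    mem_closedBall_zero_iff, LinearMap.smul_apply, LinearEquiv.coe_coe]
  constructor
  · intro h
    refine ⟨R • e.symm (z - c), ?_, by simp [smul_smul, hR.ne']⟩
    have h1 := he (e.symm (z - c))
    rw [e.apply_symm_apply] at h1
    have : ‖e.symm (z - c)‖ ≤ 1 := by
      rw [h1] at h; exact (sq_le_one_iff₀ (norm_nonneg _)).1 h
    rw [norm_smul, Real.norm_of_nonneg hR.le]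
    nlinarith
  · rintro ⟨a, ha, rfl⟩
    rw [add_sub_cancel_left, ← map_smul, he, sq_le_one_iff₀ (norm_nonneg _), norm_smul,
      norm_inv, Real.norm_of_nonneg hR.le, inv_mul_le_iff₀ hR, mul_one]
    exact ha

theorem isEllipsoidAt_closedBall {ι : Type*} [Fintype ι] {R : ℝ} (hR : 0 < R) :
    IsEllipsoidAt (0 : EuclideanSpace ℝ ι) (Metric.closedBall 0 R) := by
  refine ⟨(R⁻¹ ^ 2) • LinearMap.BilinMap.toQuadraticMap (innerₗ (EuclideanSpace ℝ ι)), ?_, ?_⟩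
  · refine QuadraticMap.PosDef.smul (fun z hz => ?_) (by positivity)
    simpa using pow_pos (norm_pos_iff.2 hz) 2
  · ext z
    simp only [mem_closedBall_zero_iff, Set.mem_ofPred_eq, sub_zero, _root_.smul_apply,
      LinearMap.BilinMap.toQuadraticMap_apply, innerₗ_apply_apply, real_inner_self_eq_norm_sq,
      smul_eq_mul]
    rw [← mul_pow, sq_le_one_iff₀ (by positivity), inv_mul_le_iff₀ hR, mul_one]

theorem IsEllipsoidAt.image {V W : Type*} [AddCommGroup V] [Module ℝ V] [AddCommGroup W]
    [Module ℝ W] (e : V ≃ₗ[ℝ] W) {c : V} {E : Set V} (hE : IsEllipsoidAt c E) :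
    IsEllipsoidAt (e c) (e '' E) := by
  obtain ⟨Q, hQ, rfl⟩ := hE
  refine ⟨Q.comp e.symm.toLinearMap, fun z hz => hQ _ (by simpa using hz), ?_⟩
  ext z
  constructor
  · rintro ⟨a, ha, rfl⟩
    simpa using ha
  · intro hz
    exact ⟨e.symm z, by simpa using hz, by simp⟩

/-- The support function of an ellipsoid contained in a slab bounds the corresponding row. -/
theorem norm_row_le_of_image_subset {ι : Type*} [Fintype ι] [DecidableEq ι] {R : ℝ} (hR : 0 < R)
    {c : EuclideanSpace ℝ ι} {A : Matrix ι ι ℝ} {i : ι}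
    (h : ∀ z ∈ Metric.closedBall (0 : EuclideanSpace ℝ ι) R,
      |(c + Matrix.toEuclideanLin A z) i| ≤ R) :
    |c i| + R * ‖(WithLp.toLp 2 (A i) : EuclideanSpace ℝ ι)‖ ≤ R := by
  set v : EuclideanSpace ℝ ι := WithLp.toLp 2 (A i) with hv
  -- The point of the ball where row `i` is largest; it is `0` when `v = 0`, since `0⁻¹ = 0`.
  -- Testing both `z` and `-z` yields `|c i|`.
  set z : EuclideanSpace ℝ ι := (R * ‖v‖⁻¹) • v with hz
  have hzn : ‖z‖ ≤ R := by
    rw [hz, norm_smul, norm_mul, norm_inv, norm_norm, Real.norm_of_nonneg hR.le, mul_assoc]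
    exact mul_le_of_le_one_right hR.le inv_mul_le_one
  have hin : (Matrix.toEuclideanLin A z) i = R * ‖v‖ := by
    have h1 : (Matrix.toEuclideanLin A z) i = inner ℝ z v := by
      simp [Matrix.toLpLin_apply, Matrix.mulVec, dotProduct, PiLp.inner_apply, hv]
    rw [h1, hz, real_inner_smul_left, real_inner_self_eq_norm_sq]
    rcases eq_or_ne ‖v‖ 0 with h0 | h0
    · simp [h0]
    · field_simp
  have h1 := h z (by simpa using hzn)
  have h2 := h (-z) (by simpa using hzn)
  simp only [map_neg, PiLp.add_apply, PiLp.neg_apply, hin, abs_le] at h1 h2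
  rcases abs_cases (c i) with ⟨h, _⟩ | ⟨h, _⟩ <;> rw [h] <;> linarith

/-- Among the ellipsoids inside the cube of half-width `R`, the ball of radius `R` is the only one
of maximal volume. -/
theorem IsEllipsoidAt.volume_lt_volume_closedBall {ι : Type*} [Fintype ι] {R : ℝ} (hR : 0 < R)
    {c : EuclideanSpace ℝ ι} {E : Set (EuclideanSpace ℝ ι)} (hE : IsEllipsoidAt c E)
    (hcube : ∀ z ∈ E, ∀ i, |z i| ≤ R) (hne : E ≠ Metric.closedBall 0 R) :
    MeasureTheory.volume E <
      MeasureTheory.volume (Metric.closedBall (0 : EuclideanSpace ℝ ι) R) := by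
  classical
  obtain ⟨A, rfl⟩ := hE.exists_eq_image hR
  have hrow : ∀ i, |c i| + R * ‖(WithLp.toLp 2 (A i) : EuclideanSpace ℝ ι)‖ ≤ R := fun i =>
    norm_row_le_of_image_subset hR fun z hz => hcube _ ⟨z, hz, rfl⟩ i
  have hdiag : ∀ i, (A * A.transpose) i i = ‖(WithLp.toLp 2 (A i) : EuclideanSpace ℝ ι)‖ ^ 2 :=
    fun i => by rw [EuclideanSpace.real_norm_sq_eq]; simp [Matrix.mul_apply, sq]
  have hdet : |A.det| < 1 := by
    by_contra! hge
    have hone : A * A.transpose = 1 := by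
      refine Matrix.PosSemidef.eq_one_of_diag_le_one ?_ (fun i => ?_) ?_
      · simpa using Matrix.posSemidef_self_mul_conjTranspose A
      · rw [hdiag, sq_le_one_iff₀ (norm_nonneg _)]
        have := hrow i
        have := abs_nonneg (c i)
        by_contra! hlt
        nlinarith
      · rw [Matrix.det_mul, Matrix.det_transpose, ← abs_mul_abs_self]
        nlinarith
    -- Rows of unit length use up the whole width of the cube.
    have hc : c = 0 := by
      ext i
      have h1 : ‖(WithLp.toLp 2 (A i) : EuclideanSpace ℝ ι)‖ ^ 2 = 1 := by
        rw [← hdiag, hone, Matrix.one_apply_eq]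
      have h2 : ‖(WithLp.toLp 2 (A i) : EuclideanSpace ℝ ι)‖ = 1 :=
        (pow_eq_one_iff_of_nonneg (norm_nonneg _) two_ne_zero).1 h1
      have := hrow i
      rw [h2] at this
      have h3 : |c i| ≤ 0 := by linarith
      simpa using h3
    have hone' : A.transpose * A = 1 := mul_eq_one_comm.1 hone
    have hisom : ∀ (B : Matrix ι ι ℝ), B.transpose * B = 1 → ∀ z,
        ‖Matrix.toEuclideanLin B z‖ = ‖z‖ := fun B hB z => by
      have : ‖Matrix.toEuclideanLin B z‖ ^ 2 = ‖z‖ ^ 2 := by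
        rw [EuclideanSpace.real_norm_sq_eq, EuclideanSpace.real_norm_sq_eq]
        have : (B.mulVec z.ofLp) ⬝ᵥ (B.mulVec z.ofLp) = z.ofLp ⬝ᵥ z.ofLp := by
          rw [Matrix.dotProduct_mulVec, ← Matrix.mulVec_transpose, Matrix.mulVec_mulVec, hB,
            Matrix.one_mulVec]
        simpa [dotProduct, sq, Matrix.toLpLin_apply] using this
      exact (sq_eq_sq₀ (norm_nonneg _) (norm_nonneg _)).1 this
    apply hne
    ext z
    simp only [hc, zero_add, Set.mem_image, mem_closedBall_zero_iff]
    constructor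
    · rintro ⟨a, ha, rfl⟩
      rwa [hisom A hone']
    · intro hz
      refine ⟨Matrix.toEuclideanLin A.transpose z, ?_, ?_⟩
      · rwa [hisom _ (by simpa using hone)]
      · simp [Matrix.toLpLin_apply, Matrix.mulVec_mulVec, hone]
  have himg : (fun z => c + Matrix.toEuclideanLin A z) '' Metric.closedBall 0 R =
      (fun z => c + z) '' (Matrix.toEuclideanLin A '' Metric.closedBall 0 R) := by
    rw [Set.image_image]
  have hA : LinearMap.det (Matrix.toEuclideanLin A) = A.det := by
    rw [Matrix.toEuclideanLin, Matrix.toLpLin_eq_toLin, LinearMap.det_toLin]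
  rw [himg, Set.image_add_left, MeasureTheory.measure_preimage_add,
    MeasureTheory.Measure.addHaar_image_linearMap, hA]
  have hpos := Metric.measure_closedBall_pos MeasureTheory.volume (0 : EuclideanSpace ℝ ι) hR
  have hfin := (isCompact_closedBall (0 : EuclideanSpace ℝ ι) R).measure_lt_top
    (μ := MeasureTheory.volume)
  calc _ < 1 * MeasureTheory.volume (Metric.closedBall (0 : EuclideanSpace ℝ ι) R) :=
        (ENNReal.mul_lt_mul_iff_left hpos.ne' hfin.ne).2 (by simpa using hdet)
    _ = _ := one_mul _

/-! ### Symplectic form and symplectic matrices -/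

theorem posPart_coord {n : ℕ} (z : PhaseSpace n) (i : Fin n) :
    (posPart z).ofLp i = z (Sum.inl i) := rfl

theorem momPart_coord {n : ℕ} (z : PhaseSpace n) (i : Fin n) :
    (momPart z).ofLp i = z (Sum.inr i) := rfl

theorem stdSymp_eq_sum {n : ℕ} (z w : PhaseSpace n) :
    stdSymp z w =
      ∑ i, z (Sum.inr i) * w (Sum.inl i) - ∑ i, z (Sum.inl i) * w (Sum.inr i) := by
  simp [stdSymp, posPart_coord, momPart_coord, PiLp.inner_apply, mul_comm]

theorem stdSymp_eq_dotProduct {n : ℕ} (z w : PhaseSpace n) :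
    stdSymp z w = z.ofLp ⬝ᵥ (Matrix.J (Fin n) ℝ).mulVec w.ofLp := by
  rw [stdSymp_eq_sum, dotProduct, Fintype.sum_sum_type]
  simp [Matrix.J, Matrix.fromBlocks_mulVec, Matrix.neg_mulVec]
  ring

theorem stdSymp_swap {n : ℕ} (z w : PhaseSpace n) : stdSymp z w = -stdSymp w z := by
  simp only [stdSymp, real_inner_comm]
  ring

theorem stdSymp_add_left {n : ℕ} (z z' w : PhaseSpace n) :
    stdSymp (z + z') w = stdSymp z w + stdSymp z' w := by
  simp [stdSymp_eq_dotProduct, add_dotProduct]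

theorem stdSymp_add_right {n : ℕ} (z w w' : PhaseSpace n) :
    stdSymp z (w + w') = stdSymp z w + stdSymp z w' := by
  simp [stdSymp_eq_dotProduct, Matrix.mulVec_add, dotProduct_add]

theorem stdSymp_smul_left {n : ℕ} (a : ℝ) (z w : PhaseSpace n) :
    stdSymp (a • z) w = a * stdSymp z w := by
  simp [stdSymp_eq_dotProduct]

theorem stdSymp_smul_right {n : ℕ} (a : ℝ) (z w : PhaseSpace n) :
    stdSymp z (a • w) = a * stdSymp z w := by
  simp [stdSymp_eq_dotProduct, Matrix.mulVec_smul]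

/-- The symplectic form as a bilinear map. -/
noncomputable def stdSympBilin (n : ℕ) : PhaseSpace n →ₗ[ℝ] PhaseSpace n →ₗ[ℝ] ℝ :=
  LinearMap.mk₂ ℝ stdSymp stdSymp_add_left stdSymp_smul_left stdSymp_add_right stdSymp_smul_right

theorem eq_zero_of_stdSymp_eq_zero {n : ℕ} {z : PhaseSpace n} (h : ∀ w, stdSymp z w = 0) :
    z = 0 := by
  ext i
  rcases i with i | i
  · simpa [stdSymp_eq_sum, Pi.single_apply] using h (EuclideanSpace.single (Sum.inr i) 1)
  · simpa [stdSymp_eq_sum, Pi.single_apply] using h (EuclideanSpace.single (Sum.inl i) 1)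

/-- A linear map preserving the symplectic form is given by a symplectic matrix. -/
theorem mem_symplecticGroup_of_stdSymp {n : ℕ} {T : PhaseSpace n →ₗ[ℝ] PhaseSpace n}
    (hT : ∀ z w, stdSymp (T z) (T w) = stdSymp z w) :
    Matrix.toEuclideanLin.symm T ∈ Matrix.symplecticGroup (Fin n) ℝ := by
  obtain ⟨M, rfl⟩ := Matrix.toEuclideanLin.surjective T
  rw [LinearEquiv.symm_apply_apply, SymplecticGroup.mem_iff']
  refine Matrix.ext_of_mulVec_single fun j => ?_
  refine dotProduct_eq _ _ fun v => ?_
  have h := hT (WithLp.toLp 2 v) (WithLp.toLp 2 (Pi.single j 1))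
  simp only [stdSymp_eq_dotProduct, Matrix.toLpLin_apply] at h
  rw [dotProduct_comm, dotProduct_comm _ v, ← h, ← Matrix.mulVec_mulVec, ← Matrix.mulVec_mulVec,
    Matrix.dotProduct_mulVec, Matrix.vecMul_transpose]

/-- The linear equivalence of phase space given by a symplectic matrix. -/
noncomputable def symplecticEquiv {n : ℕ} (S : Matrix.symplecticGroup (Fin n) ℝ) :
    PhaseSpace n ≃ₗ[ℝ] PhaseSpace n :=
  LinearEquiv.ofBijective
    (Matrix.toEuclideanLin (S : Matrix (Fin n ⊕ Fin n) (Fin n ⊕ Fin n) ℝ)) <| by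
    have h : Function.Injective
        (Matrix.toEuclideanLin (S : Matrix (Fin n ⊕ Fin n) (Fin n ⊕ Fin n) ℝ)) := by
      refine (injective_iff_map_eq_zero _).2 fun z hz => ?_
      have hS := SymplecticGroup.symplectic_det S.2
      have h0 : (S : Matrix (Fin n ⊕ Fin n) (Fin n ⊕ Fin n) ℝ).mulVec z.ofLp = 0 := by
        simpa [Matrix.toLpLin_apply] using hz
      have := Matrix.eq_zero_of_mulVec_eq_zero hS.ne_zero h0
      ext i; simpa using congrFun this i
    exact ⟨h, LinearMap.injective_iff_surjective.1 h⟩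

theorem spImage_eq_image {n : ℕ} (S : Matrix.symplecticGroup (Fin n) ℝ)
    (A : Set (PhaseSpace n)) : spImage S A = symplecticEquiv S '' A := rfl

/-! ### Transport of John ellipsoids and the ball product -/

theorem IsJohnEllipsoid.spImage {n : ℕ} {Ω E : Set (PhaseSpace n)} (h : IsJohnEllipsoid Ω E)
    (S : Matrix.symplecticGroup (Fin n) ℝ) :
    IsJohnEllipsoid (spImage S Ω) (spImage S E) := by
  obtain ⟨⟨⟨c, hc⟩, hsub⟩, hmax⟩ := h
  simp only [spImage_eq_image]
  set e := symplecticEquiv S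
  refine ⟨⟨⟨_, hc.image e⟩, Set.image_mono hsub⟩, ?_⟩
  rintro E' ⟨c', hc'⟩ hE' hne
  have hE'' : E' = e '' (e.symm '' E') := by
    simp [Set.image_image]
  have hlt := hmax (e.symm '' E') ⟨_, hc'.image e.symm⟩
    (by rw [← Set.image_subset_image_iff e.injective, ← hE'']; exact hE')
    (fun h => hne (by rw [hE'', h]))
  -- Only a nonzero determinant is needed: the same factor multiplies both volumes.
  have hdet : LinearMap.det (e : PhaseSpace n →ₗ[ℝ] PhaseSpace n) ≠ 0 := e.isUnit_det'.ne_zero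
  rw [hE'']
  have himg : ∀ s : Set (PhaseSpace n), e '' s = (e : PhaseSpace n →ₗ[ℝ] PhaseSpace n) '' s :=
    fun s => rfl
  rw [himg, himg, MeasureTheory.Measure.addHaar_image_linearMap,
    MeasureTheory.Measure.addHaar_image_linearMap]
  exact (ENNReal.mul_lt_mul_iff_right (by simpa using hdet) ENNReal.ofReal_ne_top).2 hlt

theorem norm_sq_eq_posPart_add_momPart {n : ℕ} (z : PhaseSpace n) :
    ‖z‖ ^ 2 = ‖posPart z‖ ^ 2 + ‖momPart z‖ ^ 2 := by
  simp only [EuclideanSpace.real_norm_sq_eq, Fintype.sum_sum_type, posPart_coord, momPart_coord]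

theorem isJohnEllipsoid_ballProduct {n : ℕ} {R : ℝ} (hR : 0 < R) :
    IsJohnEllipsoid (ballProduct n R) (Metric.closedBall 0 R) := by
  refine ⟨⟨⟨0, isEllipsoidAt_closedBall hR⟩, fun z hz => ?_⟩, ?_⟩
  · have h := norm_sq_eq_posPart_add_momPart z
    rw [mem_closedBall_zero_iff] at hz
    have hz2 : ‖z‖ ^ 2 ≤ R ^ 2 := pow_le_pow_left₀ (norm_nonneg _) hz 2
    refine ⟨mem_closedBall_zero_iff.2 (abs_le_of_sq_le_sq' ?_ hR.le).2,
      mem_closedBall_zero_iff.2 (abs_le_of_sq_le_sq' ?_ hR.le).2⟩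
    · linarith [sq_nonneg ‖momPart z‖]
    · linarith [sq_nonneg ‖posPart z‖]
  · rintro E ⟨c, hE⟩ hsub hne
    refine hE.volume_lt_volume_closedBall hR (fun z hz i => ?_) hne
    obtain ⟨h1, h2⟩ := hsub hz
    rw [mem_closedBall_zero_iff] at h1 h2
    rcases i with i | i
    · exact (PiLp.norm_apply_le (posPart z) i).trans h1
    · exact (PiLp.norm_apply_le (momPart z) i).trans h2

/-! ### Lagrangian frames and polar duality -/

/-- Every linear parametrisation of the first plane of a Lagrangian frame has a symplectically dual
parametrisation of the second plane. -/
theorem IsLagrangianFrame.exists_dual {n : ℕ} {l l' : Submodule ℝ (PhaseSpace n)}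
    (hl : IsLagrangianFrame l l') (e : EuclideanSpace ℝ (Fin n) ≃ₗ[ℝ] l) :
    ∃ f : EuclideanSpace ℝ (Fin n) ≃ₗ[ℝ] l',
      ∀ a b, stdSymp (f b : PhaseSpace n) (e a) = inner ℝ b a := by
  obtain ⟨⟨hd, h0⟩, ⟨hd', h0'⟩, hinf⟩ := hl
  have htop : l ⊔ l' = ⊤ := by
    apply Submodule.eq_top_of_finrank_eq
    have := Submodule.finrank_sup_add_finrank_inf_eq l l'
    rw [hinf, hd, hd', finrank_bot] at this
    simpa using this
  let φ : l' →ₗ[ℝ] Module.Dual ℝ (EuclideanSpace ℝ (Fin n)) :=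
    (LinearMap.lcomp ℝ ℝ (l.subtype ∘ₗ e.toLinearMap)) ∘ₗ stdSympBilin n ∘ₗ l'.subtype
  have hφ : ∀ z' a, φ z' a = stdSymp (z' : PhaseSpace n) (e a) := fun z' a => rfl
  let ψ : EuclideanSpace ℝ (Fin n) ≃ₗ[ℝ] Module.Dual ℝ (EuclideanSpace ℝ (Fin n)) :=
    (InnerProductSpace.toDual ℝ (EuclideanSpace ℝ (Fin n))).toLinearEquiv.trans
      LinearMap.toContinuousLinearMap.symm
  have hψ : ∀ b a, ψ b a = inner ℝ b a := fun b a => rfl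
  -- A kernel element is `σ`-orthogonal to `l` by assumption and to `l'` by isotropy, hence to the
  -- whole space.
  have hinj : Function.Injective φ := by
    refine (injective_iff_map_eq_zero _).2 fun z' hz' => ?_
    refine Subtype.ext (eq_zero_of_stdSymp_eq_zero fun w => ?_)
    obtain ⟨u, hu, v, hv, rfl⟩ := Submodule.mem_sup.1 (htop ▸ Submodule.mem_top (x := w))
    have h1 := hφ z' (e.symm ⟨u, hu⟩)
    rw [hz', e.apply_symm_apply] at h1
    rw [stdSymp_add_right, h0' _ z'.2 _ hv, add_zero]
    exact h1.symm
  have hdim : Module.finrank ℝ l' =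
      Module.finrank ℝ (Module.Dual ℝ (EuclideanSpace ℝ (Fin n))) := by
    rw [hd', Subspace.dual_finrank_eq]; simp
  let Φ := LinearEquiv.ofInjectiveOfFinrankEq φ hinj hdim
  refine ⟨ψ.trans Φ.symm, fun a b => ?_⟩
  rw [← hφ, ← hψ]
  exact LinearMap.congr_fun (Φ.apply_symm_apply (ψ b)) a

/-- The polar dual of a Euclidean ball. -/
theorem norm_le_sqrt_iff_forall_neg_inner_le {F : Type*} [NormedAddCommGroup F]
    [InnerProductSpace ℝ F] {r : ℝ} (hr : 0 < r) (b : F) :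
    ‖b‖ ≤ Real.sqrt r ↔ ∀ a : F, ‖a‖ ≤ Real.sqrt r → -inner ℝ b a ≤ r := by
  have hs := Real.sqrt_pos.2 hr
  have hss := Real.mul_self_sqrt hr.le
  constructor
  · intro hb a ha
    have h1 := (abs_le.1 (abs_real_inner_le_norm b a)).1
    nlinarith [norm_nonneg a, norm_nonneg b, mul_le_mul hb ha (norm_nonneg a) hs.le]
  · intro h
    rcases eq_or_ne b 0 with rfl | hb
    · simp
    have hb' := norm_pos_iff.2 hb
    -- The extremal test vector: opposite to `b`, of length `√r`.
    have h1 := h (-(Real.sqrt r * ‖b‖⁻¹) • b) (by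
      rw [norm_smul, norm_neg, norm_mul, norm_inv, norm_norm, Real.norm_of_nonneg hs.le,
        mul_assoc, inv_mul_cancel₀ hb'.ne', mul_one])
    rw [real_inner_smul_right, real_inner_self_eq_norm_sq] at h1
    have h2 : -(-(Real.sqrt r * ‖b‖⁻¹) * ‖b‖ ^ 2) = Real.sqrt r * ‖b‖ := by field_simp
    rw [h2] at h1
    by_contra! hlt
    nlinarith

theorem exists_geometricState_eq_spImage {n : ℕ} {ħ : ℝ} (hħ : 0 < ħ)
    {l l' : Submodule ℝ (PhaseSpace n)} (hl : IsLagrangianFrame l l')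
    {X : Set (PhaseSpace n)} (hX : IsCenteredEllipsoidIn l X) :
    ∃ S : Matrix.symplecticGroup (Fin n) ℝ,
      geometricState ħ l' X = spImage S (ballProduct n (Real.sqrt ħ)) := by
  have hs := Real.sqrt_pos.2 hħ
  obtain ⟨_, ⟨Q, hQ, rfl⟩, hXQ⟩ := hX
  obtain ⟨e₀, he₀⟩ := exists_linearEquiv_norm_sq (ι := Fin n) (by simpa using hl.1.1) Q hQ
  -- Rescaling turns the unit ball into the ball of radius `√ħ`, the self-dual radius.
  let e : EuclideanSpace ℝ (Fin n) ≃ₗ[ℝ] l :=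
    (LinearEquiv.smulOfNeZero ℝ _ (Real.sqrt ħ)⁻¹ (inv_ne_zero hs.ne')).trans e₀
  have he : ∀ a, Q (e a) ≤ 1 ↔ ‖a‖ ≤ Real.sqrt ħ := fun a => by
    change Q (e₀ ((Real.sqrt ħ)⁻¹ • a)) ≤ 1 ↔ _
    rw [he₀, sq_le_one_iff₀ (norm_nonneg _), norm_smul, norm_inv, Real.norm_of_nonneg hs.le,
      inv_mul_le_iff₀ hs, mul_one]
  have hXe : ∀ z, z ∈ X ↔ ∃ a, ‖a‖ ≤ Real.sqrt ħ ∧ (e a : PhaseSpace n) = z := fun z => by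
    rw [hXQ]
    constructor
    · rintro ⟨y, hy, rfl⟩
      refine ⟨e.symm y, (he _).1 ?_, by simp⟩
      simpa using hy
    · rintro ⟨a, ha, rfl⟩
      exact ⟨e a, by simpa using (he a).2 ha, rfl⟩
  obtain ⟨f, hf⟩ := hl.exists_dual e
  have hdual : ∀ z, z ∈ lagrangianPolarDual ħ l' X ↔
      ∃ b, ‖b‖ ≤ Real.sqrt ħ ∧ (f b : PhaseSpace n) = z := fun z => by
    have key : ∀ b, (∀ x ∈ X, stdSymp x (f b : PhaseSpace n) ≤ ħ) ↔ ‖b‖ ≤ Real.sqrt ħ :=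
      fun b => by
        rw [norm_le_sqrt_iff_forall_neg_inner_le hħ]
        constructor
        · intro h a ha
          rw [← hf, ← stdSymp_swap]
          exact h _ ((hXe _).2 ⟨a, ha, rfl⟩)
        · intro h x hx
          obtain ⟨a, ha, rfl⟩ := (hXe _).1 hx
          rw [stdSymp_swap, hf]
          exact h a ha
    constructor
    · rintro ⟨hz, h⟩
      refine ⟨f.symm ⟨z, hz⟩, (key _).1 ?_, by simp⟩
      simpa using h
    · rintro ⟨b, hb, rfl⟩
      exact ⟨(f b).2, (key b).2 hb⟩
  let pos : PhaseSpace n →ₗ[ℝ] EuclideanSpace ℝ (Fin n) :=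
    { toFun := posPart, map_add' := fun _ _ => rfl, map_smul' := fun _ _ => rfl }
  let mom : PhaseSpace n →ₗ[ℝ] EuclideanSpace ℝ (Fin n) :=
    { toFun := momPart, map_add' := fun _ _ => rfl, map_smul' := fun _ _ => rfl }
  let T : PhaseSpace n →ₗ[ℝ] PhaseSpace n :=
    l.subtype ∘ₗ e.toLinearMap ∘ₗ pos + l'.subtype ∘ₗ f.toLinearMap ∘ₗ mom
  have hT : ∀ z, T z = (e (posPart z) : PhaseSpace n) + f (momPart z) := fun z => rfl
  -- Isotropy kills the terms within `l` and within `l'`; duality of `e` and `f` turns the cross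
  -- terms into `σ`.
  have hTs : ∀ z w, stdSymp (T z) (T w) = stdSymp z w := fun z w => by
    rw [hT, hT, stdSymp_add_left, stdSymp_add_right, stdSymp_add_right, hf,
      hl.1.2 _ (e _).2 _ (e _).2, hl.2.1.2 _ (f _).2 _ (f _).2,
      stdSymp_swap (e (posPart z) : PhaseSpace n), hf, stdSymp,
      real_inner_comm (momPart w) (posPart z)]
    ring
  refine ⟨⟨_, mem_symplecticGroup_of_stdSymp hTs⟩, ?_⟩
  rw [spImage, LinearEquiv.apply_symm_apply]
  ext z
  rw [geometricState, Set.mem_add]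
  constructor
  · rintro ⟨x, hx, y, hy, rfl⟩
    obtain ⟨a, ha, rfl⟩ := (hXe _).1 hx
    obtain ⟨b, hb, rfl⟩ := (hdual _).1 hy
    exact ⟨WithLp.toLp 2 (Sum.elim a b), ⟨mem_closedBall_zero_iff.2 ha,
      mem_closedBall_zero_iff.2 hb⟩, rfl⟩
  · rintro ⟨w, ⟨h1, h2⟩, rfl⟩
    exact ⟨_, (hXe _).2 ⟨_, mem_closedBall_zero_iff.1 h1, rfl⟩, _,
      (hdual _).2 ⟨_, mem_closedBall_zero_iff.1 h2, rfl⟩, rfl⟩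

theorem mainTheorem8 (n : ℕ) (ħ : ℝ) (hħ : 0 < ħ)
    (l l' : Submodule ℝ (PhaseSpace n)) (hl : IsLagrangianFrame l l')
    (X : Set (PhaseSpace n)) (hX : IsCenteredEllipsoidIn l X) :
    (∃ S : Matrix.symplecticGroup (Fin n) ℝ,
      geometricState ħ l' X = spImage S (ballProduct n (Real.sqrt ħ))) ∧
    (∃ S' : Matrix.symplecticGroup (Fin n) ℝ,
      IsJohnEllipsoid (geometricState ħ l' X) (quantumBlob ħ S')) := by
  obtain ⟨S, hS⟩ := exists_geometricState_eq_spImage hħ hl hX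
  refine ⟨⟨S, hS⟩, S, ?_⟩
  rw [hS]
  exact (isJohnEllipsoid_ballProduct (Real.sqrt_pos.2 hħ)).spImage S
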